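/- Let $d\ge 0$, let $\sigma\subset\mathbb{R}^d$ be a strongly convex, full-dimensional rational polyhedral cone with dual cone $\sigma^\vee$, and let $S=\mathbb{C}[\sigma^\vee\cap\mathbb{Z}^d]$ be the algebra with $\mathbb{C}$-basis the monomials $x^\beta$, $\beta\in\sigma^\vee\cap\mathbb{Z}^d$. Let $I\subset S$ be a non-zero ideal. For $w\in\sigma$ and $f\in S$ let $\mathrm{in}_w(f)$ be the sum of the terms $c_\beta x^\beta$ of $f$ for which $w\cdot\beta$ is maximal (and $\mathrm{in}_w(0)=0$); let $\mathrm{in}_w(I)=\langle \mathrm{in}_w(f)\mid f\in I\rangle$ and $C[w]=\{w'\in\sigma\mid \mathrm{in}_{w'}(I)=\mathrm{in}_w(I)\}$. The Gröbner fan of $I$ is $\mathrm{GF}(I)=\{\overline{C[w]}\mid w\in\sigma\}$, where the bar denotes closure in $\mathbb{R}^d$. A monomial ordering on $S$ is a total ordering $\preceq$ of the monomials of $S$ such that $x^\beta\preceq x^\alpha$ whenever $x^\beta$ divides $x^\alpha$ in $S$, and such that $x^\beta\preceq x^\alpha$ implies $x^{\beta+\gamma}\preceq x^{\alpha+\gamma}$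 for all $x^\gamma\in S$. A finite set of non-zero elements $g_1,\dots,g_t$ of $I$ is a Gröbner basis of $I$ with respect to $\preceq$ if the leading monomial of every non-zero element of $I$ is divisible in $S$ by the leading monomial of some $g_i$; it is reduced if every $g_i$ has leading coefficient $1$ and no monomial occurring in $g_i$ is divisible by the leading monomial of $g_j$ for any $j\ne i$. A marked Gröbner basis of $I$ is a set $\mathbb{G}=\{(g_1,x^{\alpha_1}),\dots,(g_t,x^{\alpha_t})\}$, where $\{g_1,\dots,g_t\}$ is the reduced Gröbner basis of $I$ with respect to some monomial ordering and $x^{\alpha_i}$ is the leading monomial of $g_i$ for that ordering. Put $$C_{\mathbb{G}}=\{w\in\sigma\mid (\alpha_i-\beta)\cdot w\ge 0 \text{ for all } i \text{ and all monomials } x^\beta \text{ occurring in } g_i\}.$$ Then: 1. for every marked Gröbner basis $\mathbb{G}$ of $I$, the cone $C_{\mathbb{G}}$ is an element of $\mathrm{GF}(I)$; 2. conversely, every maximal cone of $\mathrm{GF}(I)$ (with respect to inclusion) equals $C_{\mathbb{G}}$ for some marked Gröbner basis $\mathbb{G}$ of $I$. -/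

import Mathlib

namespace ToricGroebner

/-- `σ` is generated by finitely many lattice vectors. -/
def IsRationalPolyhedral {d : ℕ} (σ : PointedCone ℝ (Fin d → ℝ)) : Prop :=
  ∃ V : Finset (Fin d → ℤ),
    σ = PointedCone.hull ℝ ((fun (v : Fin d → ℤ) (i : Fin d) => (v i : ℝ)) '' (V : Set (Fin d → ℤ)))

/-- `σ ∩ (-σ) = {0}`. -/
def IsStronglyConvex {d : ℕ} (σ : PointedCone ℝ (Fin d → ℝ)) : Prop :=
  ∀ w, w ∈ σ → -w ∈ σ → w = 0

/-- `σ` spans the ambient real vector space. -/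
def IsFullDimensional {d : ℕ} (σ : PointedCone ℝ (Fin d → ℝ)) : Prop :=
  Submodule.span ℝ (σ : Set (Fin d → ℝ)) = ⊤

/-- The standard inner product of a real vector with a lattice point. -/
def dot {d : ℕ} (w : Fin d → ℝ) (β : Fin d → ℤ) : ℝ := ∑ i, w i * (β i : ℝ)

/-- The monoid `σ^∨ ∩ ℤ^d` of lattice points of the dual cone. -/
def dualMonoid {d : ℕ} (σ : PointedCone ℝ (Fin d → ℝ)) : AddSubmonoid (Fin d → ℤ) where
  carrier := {β | ∀ w ∈ σ, 0 ≤ dot w β}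
  zero_mem' := by
    intro w _
    simp [dot]
  add_mem' := by
    intro a b ha hb w hw
    have h : dot w (a + b) = dot w a + dot w b := by
      simp [dot, mul_add, Finset.sum_add_distrib]
    rw [h]
    exact add_nonneg (ha w hw) (hb w hw)

/-- The monomials `x^β` of the algebra, given by their exponents `β ∈ σ^∨ ∩ ℤ^d`. -/
abbrev Exponent {d : ℕ} (σ : PointedCone ℝ (Fin d → ℝ)) : Type := ↥(dualMonoid σ)

/-- The monomial algebra `S = ℂ[σ^∨ ∩ ℤ^d]`. -/
abbrev MonomialAlgebra {d : ℕ} (σ : PointedCone ℝ (Fin d → ℝ)) : Type :=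
  AddMonoidAlgebra ℂ (Exponent σ)

section
variable {d : ℕ} {σ : PointedCone ℝ (Fin d → ℝ)}

/-- The exponents of the monomials occurring in `f`. -/
def supp (f : MonomialAlgebra σ) : Finset (Exponent σ) := f.coeff.support

open Classical in
/-- The initial form `in_w(f)`: the sum of the terms of `f` of maximal `w`-weight;
it is `0` for `f = 0`. -/
noncomputable def initialForm (w : Fin d → ℝ) (f : MonomialAlgebra σ) : MonomialAlgebra σ :=
  ∑ β ∈ (supp f).filter (fun β : Exponent σ => ∀ γ ∈ supp f, dot w γ ≤ dot w β),
    AddMonoidAlgebra.single β (f.coeff β)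

/-- The initial ideal `in_w(I)`. -/
noncomputable def initialIdeal (w : Fin d → ℝ) (I : Ideal (MonomialAlgebra σ)) :
    Ideal (MonomialAlgebra σ) :=
  Ideal.span (initialForm w '' (I : Set (MonomialAlgebra σ)))

/-- The class `C[w]` of all weights in `σ` with the same initial ideal as `w`. -/
def weightClass (I : Ideal (MonomialAlgebra σ)) (w : Fin d → ℝ) : Set (Fin d → ℝ) :=
  {w' | w' ∈ σ ∧ initialIdeal w' I = initialIdeal w I}

/-- The Gröbner fan `GF(I)`: the set of the closures of the classes `C[w]`, `w ∈ σ`. -/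
def groebnerFan (I : Ideal (MonomialAlgebra σ)) : Set (Set (Fin d → ℝ)) :=
  {C | ∃ w ∈ σ, C = closure (weightClass I w)}

/-- `x^β` divides `x^α` in `S`. -/
def Divides (β α : Exponent σ) : Prop := ∃ γ : Exponent σ, α = β + γ

end

/-- A monomial ordering on `S = ℂ[σ^∨ ∩ ℤ^d]`: a total ordering of its monomials that refines
divisibility in `S` and is compatible with multiplication by monomials of `S`. -/
structure MonomialOrdering {d : ℕ} (σ : PointedCone ℝ (Fin d → ℝ)) where
  /-- The ordering, on exponents. -/
  le : Exponent σ → Exponent σ → Prop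
  refl : ∀ α, le α α
  trans : ∀ α β γ, le α β → le β γ → le α γ
  antisymm : ∀ α β, le α β → le β α → α = β
  total : ∀ α β, le α β ∨ le β α
  le_of_divides : ∀ β α, Divides β α → le β α
  add_le_add : ∀ β α γ, le β α → le (β + γ) (α + γ)

section
variable {d : ℕ} {σ : PointedCone ℝ (Fin d → ℝ)}

/-- The exponent of the leading monomial of `f ≠ 0` (a junk value for `f = 0`). -/
noncomputable def lm (τ : MonomialOrdering σ) (f : MonomialAlgebra σ) : Exponent σ :=
  Classical.epsilon (fun α => α ∈ supp f ∧ ∀ β ∈ supp f, τ.le β α)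

theorem lm_spec (τ : MonomialOrdering σ) {f : MonomialAlgebra σ} (hf : f ≠ 0) :
    lm τ f ∈ supp f ∧ ∀ β ∈ supp f, τ.le β (lm τ f) := by
  have key : ∀ s : Finset (Exponent σ), s.Nonempty → ∃ α, α ∈ s ∧ ∀ β ∈ s, τ.le β α := by
    intro s hs
    induction hs using Finset.Nonempty.cons_induction with
    | singleton a => exact ⟨a, by simp, by simp [τ.refl]⟩
    | cons a s ha hs ih =>
      obtain ⟨m, hm, hmax⟩ := ih
      rcases τ.total a m with h | h
      · refine ⟨m, by simp [hm], fun β hβ => ?_⟩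
        rcases Finset.mem_cons.1 hβ with rfl | hβ
        · exact h
        · exact hmax β hβ
      · refine ⟨a, by simp, fun β hβ => ?_⟩
        rcases Finset.mem_cons.1 hβ with rfl | hβ
        · exact τ.refl _
        · exact τ.trans _ _ _ (hmax β hβ) h
  have hne : (supp f).Nonempty := by
    rw [supp, Finsupp.support_nonempty_iff]
    simpa using hf
  exact Classical.epsilon_spec (key _ hne)

/-- A finite set `B` of non-zero elements of `I` is a Gröbner basis if the leading monomial of
every non-zero element of `I` is divisible by that of some element of `B`. -/
def IsGroebnerBasis (τ : MonomialOrdering σ) (I : Ideal (MonomialAlgebra σ))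
    (B : Finset (MonomialAlgebra σ)) : Prop :=
  (∀ g ∈ B, g ∈ I ∧ g ≠ 0) ∧
    ∀ f ∈ I, f ≠ 0 → ∃ g ∈ B, Divides (lm τ g) (lm τ f)

/-- A Gröbner basis is reduced if its elements have leading coefficient `1` and no monomial of
an element is divisible by the leading monomial of another one. -/
def IsReducedGroebnerBasis (τ : MonomialOrdering σ) (I : Ideal (MonomialAlgebra σ))
    (B : Finset (MonomialAlgebra σ)) : Prop :=
  IsGroebnerBasis τ I B ∧
    ∀ g ∈ B, g.coeff (lm τ g) = 1 ∧
      ∀ β ∈ supp g, ∀ h ∈ B, h ≠ g → ¬ Divides (lm τ h) β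

/-- `G` is a marked Gröbner basis of `I`: the set of pairs `(g, lm g)`, with `g` running through
the reduced Gröbner basis of `I` with respect to some monomial ordering. -/
def IsMarkedGroebnerBasis (I : Ideal (MonomialAlgebra σ))
    (G : Set (MonomialAlgebra σ × Exponent σ)) : Prop :=
  ∃ (τ : MonomialOrdering σ) (B : Finset (MonomialAlgebra σ)),
    IsReducedGroebnerBasis τ I B ∧
      G = (fun g => (g, lm τ g)) '' (B : Set (MonomialAlgebra σ))

/-- The cone `C_G` of all `w ∈ σ` with `(α - β) · w ≥ 0` for all `(g, x^α) ∈ G` and all monomials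
`x^β` of `g`. -/
def markedCone (G : Set (MonomialAlgebra σ × Exponent σ)) : Set (Fin d → ℝ) :=
  {w | w ∈ σ ∧ ∀ p ∈ G, ∀ β ∈ supp p.1,
    0 ≤ dot w ((p.2 : Fin d → ℤ) - (β : Fin d → ℤ))}

end

end ToricGroebner

namespace ToricGroebner

/-! Call a weight `w` in the cone strict for a reduced Gröbner basis `B` if, in each `g ∈ B`, the
leading monomial has strictly larger `w`-weight than every other monomial. Strict weights exist
(`exists_strict_weight`), by a theorem of the alternative over the integers
(`exists_forall_sum_pos`). For a strict weight, division by `B` lowers the ordering and the weight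
together, so the initial ideal is the monomial ideal generated by the leading monomials
(`initialIdeal_eq`). Hence all strict weights share one class. Adding a small multiple of a strict
weight to a point of the marked cone gives a strict weight, so the cone lies in the closure of the
class. Conversely, if `w'` is in the class, reducedness forces the leading monomial of each `g` to
have maximal `w'`-weight. The marked cone is closed, so it equals that closure.

For the second claim, order monomials by `w` and break ties by any monomial ordering. Elements of
the initial ideal lift to `I` one weight level at a time, so reducedness again gives `C[w] ⊆ C_G`
(`weightClass_subset_markedCone`). Since `C_G` is itself in the fan, maximality gives equality. -/

/-- Integer vectors lying in a set that is closed under addition and does not contain `0` are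
simultaneously positive on some real functional. -/
theorem exists_forall_sum_pos {n : ℕ} (P : Set (Fin n → ℤ))
    (hadd : ∀ x ∈ P, ∀ y ∈ P, x + y ∈ P) (h0 : (0 : Fin n → ℤ) ∉ P)
    (A : Finset (Fin n → ℤ)) (hA : ∀ a ∈ A, a ∈ P) :
    ∃ w : Fin n → ℝ, ∀ a ∈ A, 0 < ∑ i, w i * (a i : ℝ) := by
  classical
  induction n with
  | zero =>
    exact ⟨0, fun a ha => absurd (Subsingleton.elim a 0 ▸ hA a ha) h0⟩
  | succ n ih =>
    have hsmul : ∀ k : ℕ, ∀ x ∈ P, (k + 1) • x ∈ P := by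
      intro k x hx
      induction k with
      | zero => simpa using hx
      | succ k ihk => rw [succ_nsmul]; exact hadd _ ihk _ hx
    have hzsmul : ∀ k : ℤ, 0 < k → ∀ x ∈ P, k • x ∈ P := by
      intro k hk x hx
      obtain ⟨m, rfl⟩ : ∃ m : ℕ, k = (m + 1 : ℕ) := ⟨(k - 1).toNat, by omega⟩
      rw [natCast_zsmul]
      exact hsmul m x hx
    let pos := A.filter (fun a => 0 < a 0)
    let neg := A.filter (fun a => a 0 < 0)
    let zer := A.filter (fun a => a 0 = 0)
    -- Fourier–Motzkin elimination: a positive combination of a vector with positive and one with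
    -- negative first coordinate, chosen to cancel that coordinate. Induction applies to the slice
    -- of `P` where it vanishes.
    let comb : (Fin (n + 1) → ℤ) × (Fin (n + 1) → ℤ) → Fin (n + 1) → ℤ :=
      fun p => (-(p.2 0)) • p.1 + (p.1 0) • p.2
    have hcomb : ∀ p ∈ pos ×ˢ neg, comb p ∈ P ∧ comb p 0 = 0 := by
      intro p hp
      simp only [Finset.mem_product, Finset.mem_filter, pos, neg] at hp
      refine ⟨hadd _ (hzsmul _ (by omega) _ (hA _ hp.1.1)) _ (hzsmul _ hp.1.2 _ (hA _ hp.2.1)), ?_⟩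
      simp only [comb, Pi.add_apply, Pi.smul_apply, smul_eq_mul]
      ring
    have hcons : ∀ a : Fin (n + 1) → ℤ, a 0 = 0 → (Fin.cons 0 (Fin.tail a) : Fin (n + 1) → ℤ) = a := by
      intro a ha
      rw [← ha, Fin.cons_self_tail]
    obtain ⟨w, hw⟩ := ih {x | (Fin.cons 0 x : Fin (n + 1) → ℤ) ∈ P}
      (by
        intro x hx y hy
        have h := hadd _ hx _ hy
        have he : (Fin.cons 0 (x + y) : Fin (n + 1) → ℤ) =
            (Fin.cons 0 x : Fin (n + 1) → ℤ) + (Fin.cons 0 y : Fin (n + 1) → ℤ) := by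
          ext i
          refine Fin.cases ?_ (fun i => ?_) i <;> simp
        change _ ∈ P
        rw [he]
        exact h)
      (by
        intro h
        apply h0
        exact (hcons 0 rfl) ▸ h)
      ((zer ∪ (pos ×ˢ neg).image comb).image Fin.tail)
      (by
        intro a ha
        obtain ⟨b, hb, rfl⟩ := Finset.mem_image.1 ha
        rcases Finset.mem_union.1 hb with hb | hb
        · have hb := Finset.mem_filter.1 hb
          simpa [hcons b hb.2] using hA b hb.1
        · obtain ⟨p, hp, rfl⟩ := Finset.mem_image.1 hb
          have := hcomb p hp
          simpa [hcons _ this.2] using this.1)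
    let s : (Fin (n + 1) → ℤ) → ℝ := fun a => ∑ i, w i * (Fin.tail a i : ℝ)
    have hsum : ∀ (t : ℝ) (a : Fin (n + 1) → ℤ),
        ∑ i, (Fin.cons t w : Fin (n + 1) → ℝ) i * (a i : ℝ) = t * a 0 + s a := by
      intro t a
      simp [Fin.sum_univ_succ, s, Fin.tail]
    have hzer : ∀ a ∈ A, a 0 = 0 → 0 < s a := fun a ha ha0 =>
      hw _ (Finset.mem_image_of_mem _ (Finset.mem_union_left _ (Finset.mem_filter.2 ⟨ha, ha0⟩)))
    -- Vectors in `pos` bound the missing first weight `t` below, those in `neg` bound it above;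
    -- positivity on `comb` says exactly that these bounds are compatible.
    have hpn : ∀ p ∈ pos, ∀ q ∈ neg, -(s p / p 0) < s q / (-(q 0 : ℝ)) := by
      intro p hp q hq
      have h := hw _ (Finset.mem_image_of_mem _ (Finset.mem_union_right _
        (Finset.mem_image_of_mem comb (Finset.mk_mem_product hp hq))))
      have hp0 : (0 : ℝ) < p 0 := by exact_mod_cast (Finset.mem_filter.1 hp).2
      have hq0 : (0 : ℝ) < -(q 0 : ℝ) := by
        have : (q 0 : ℝ) < 0 := by exact_mod_cast (Finset.mem_filter.1 hq).2
        linarith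
      have he : ∑ i, w i * (Fin.tail (comb (p, q)) i : ℝ) = -(q 0 : ℝ) * s p + p 0 * s q := by
        simp only [s, Finset.mul_sum, ← Finset.sum_add_distrib]
        refine Finset.sum_congr rfl fun i _ => ?_
        simp only [comb, Fin.tail, Pi.add_apply, Pi.smul_apply, smul_eq_mul]
        push_cast
        ring
      rw [he] at h
      rw [← neg_div, div_lt_div_iff₀ hp0 hq0]
      linarith
    obtain ⟨t, ht1, ht2⟩ : ∃ t : ℝ, (∀ p ∈ pos, -(s p / p 0) < t) ∧
        ∀ q ∈ neg, t < s q / (-(q 0 : ℝ)) := by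
      have := Set.Finite.exists_between' (α := ℝ)
        (pos.image (fun p => -(s p / p 0))).finite_toSet
        (neg.image (fun q => s q / (-(q 0 : ℝ)))).finite_toSet
        (by
          intro x hx y hy
          simp only [Finset.coe_image, Set.mem_image, Finset.mem_coe] at hx hy
          obtain ⟨p, hp, rfl⟩ := hx
          obtain ⟨q, hq, rfl⟩ := hy
          exact hpn p hp q hq)
      obtain ⟨t, h1, h2⟩ := this
      exact ⟨t, fun p hp => h1 _ (Finset.mem_coe.2 (Finset.mem_image_of_mem _ hp)),
        fun q hq => h2 _ (Finset.mem_coe.2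
          (Finset.mem_image_of_mem (fun q => s q / (-(q 0 : ℝ))) hq))⟩
    refine ⟨Fin.cons t w, fun a ha => ?_⟩
    rw [hsum]
    rcases lt_trichotomy (a 0) 0 with h | h | h
    · have h1 := ht2 a (Finset.mem_filter.2 ⟨ha, h⟩)
      have h2 : (a 0 : ℝ) < 0 := by exact_mod_cast h
      rw [lt_div_iff₀ (by linarith)] at h1
      linarith
    · simpa [h] using hzer a ha h
    · have h1 := ht1 a (Finset.mem_filter.2 ⟨ha, h⟩)
      have h2 : (0 : ℝ) < a 0 := by exact_mod_cast h
      rw [← neg_div, div_lt_iff₀ h2] at h1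
      linarith

/-! ### Rational cones through their generators -/

section Generators
variable {d : ℕ} {σ : PointedCone ℝ (Fin d → ℝ)} {m : ℕ} {v : Fin m → Fin d → ℤ}

/-- `σ` is the set of nonnegative real combinations of the lattice vectors `v i`. -/
def IsGeneratedBy (σ : PointedCone ℝ (Fin d → ℝ)) (v : Fin m → Fin d → ℤ) : Prop :=
  ∀ w, w ∈ σ ↔ ∃ c : Fin m → ℝ, (∀ i, 0 ≤ c i) ∧ w = fun j => ∑ i, c i * (v i j : ℝ)

theorem IsRationalPolyhedral.exists_isGeneratedBy (h : IsRationalPolyhedral σ) :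
    ∃ (m : ℕ) (v : Fin m → Fin d → ℤ), IsGeneratedBy σ v := by
  obtain ⟨V, hV⟩ := h
  refine ⟨V.card, fun i => (V.equivFin.symm i : Fin d → ℤ), fun w => ?_⟩
  have hr : (fun (u : Fin d → ℤ) (i : Fin d) => (u i : ℝ)) '' (V : Set (Fin d → ℤ)) =
      Set.range (fun (i : Fin V.card) (j : Fin d) => ((V.equivFin.symm i : Fin d → ℤ) j : ℝ)) := by
    ext x
    constructor
    · rintro ⟨u, hu, rfl⟩
      exact ⟨V.equivFin ⟨u, hu⟩, by simp⟩
    · rintro ⟨i, rfl⟩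
      exact ⟨_, (V.equivFin.symm i).2, rfl⟩
  rw [hV, hr, PointedCone.hull, Submodule.mem_span_range_iff_exists_fun]
  constructor
  · rintro ⟨c, rfl⟩
    refine ⟨fun i => c i, fun i => (c i).2, ?_⟩
    ext j
    simp only [Finset.sum_apply, Pi.smul_apply]
    rfl
  · rintro ⟨c, hc, rfl⟩
    refine ⟨fun i => ⟨c i, hc i⟩, ?_⟩
    ext j
    simp only [Finset.sum_apply, Pi.smul_apply]
    rfl

/-- The values of a lattice point on the generators. -/
def pairing (v : Fin m → Fin d → ℤ) : (Fin d → ℤ) →+ (Fin m → ℤ) where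
  toFun β i := ∑ j, v i j * β j
  map_zero' := by ext; simp
  map_add' a b := by ext; simp [mul_add, Finset.sum_add_distrib]

theorem dot_add (w : Fin d → ℝ) (a b : Fin d → ℤ) : dot w (a + b) = dot w a + dot w b := by
  simp [dot, mul_add, Finset.sum_add_distrib]

theorem dot_sub (w : Fin d → ℝ) (a b : Fin d → ℤ) : dot w (a - b) = dot w a - dot w b := by
  simp [dot, mul_sub, Finset.sum_sub_distrib]

theorem dot_combination (c : Fin m → ℝ) (β : Fin d → ℤ) :
    dot (fun j => ∑ i, c i * (v i j : ℝ)) β = ∑ i, c i * (pairing v β i : ℝ) := by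
  simp only [dot, pairing, AddMonoidHom.coe_mk, ZeroHom.coe_mk, Int.cast_sum, Int.cast_mul,
    Finset.sum_mul, Finset.mul_sum]
  rw [Finset.sum_comm]
  exact Finset.sum_congr rfl fun i _ => Finset.sum_congr rfl fun j _ => by ring

theorem IsGeneratedBy.generator_mem (hv : IsGeneratedBy σ v) (i : Fin m) :
    (fun j => (v i j : ℝ)) ∈ σ :=
  (hv _).2 ⟨Pi.single i 1, fun k => by by_cases h : k = i <;> simp [h], by
    ext j; simp [Pi.single_apply]⟩

theorem IsGeneratedBy.mem_dualMonoid (hv : IsGeneratedBy σ v) (β : Fin d → ℤ) :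
    β ∈ dualMonoid σ ↔ ∀ i, 0 ≤ pairing v β i := by
  constructor
  · intro h i
    have := h _ (hv.generator_mem i)
    have he : dot (fun j => (v i j : ℝ)) β = (pairing v β i : ℝ) := by
      simp [dot, pairing]
    rw [he] at this
    exact_mod_cast this
  · intro h w hw
    obtain ⟨c, hc, rfl⟩ := (hv w).1 hw
    rw [dot_combination]
    exact Finset.sum_nonneg fun i _ => mul_nonneg (hc i) (by exact_mod_cast h i)

theorem IsGeneratedBy.divides_iff (hv : IsGeneratedBy σ v) (β α : Exponent σ) :
    Divides β α ↔ pairing v β ≤ pairing v α := by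
  constructor
  · rintro ⟨γ, rfl⟩
    intro i
    have := (hv.mem_dualMonoid γ).1 γ.2 i
    simp only [AddSubmonoid.coe_add, map_add, Pi.add_apply]
    omega
  · intro h
    refine ⟨⟨(α : Fin d → ℤ) - β, (hv.mem_dualMonoid _).2 fun i => ?_⟩, ?_⟩
    · have : pairing v β i ≤ pairing v α i := h i
      simp only [map_sub, Pi.sub_apply]
      omega
    · ext1
      simp

theorem IsGeneratedBy.pairing_injective (hv : IsGeneratedBy σ v) (hfull : IsFullDimensional σ) :
    Function.Injective (pairing v) := by
  rw [injective_iff_map_eq_zero]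
  intro β hβ
  let L : (Fin d → ℝ) →ₗ[ℝ] ℝ :=
    { toFun := fun w => dot w β
      map_add' := fun x y => by simp [dot, add_mul, Finset.sum_add_distrib]
      map_smul' := fun c x => by simp [dot, Finset.mul_sum, mul_assoc] }
  have hle : Submodule.span ℝ (σ : Set (Fin d → ℝ)) ≤ LinearMap.ker L := by
    rw [Submodule.span_le]
    intro w hw
    obtain ⟨c, hc, rfl⟩ := (hv w).1 hw
    change dot _ β = 0
    rw [dot_combination, hβ]
    simp
  rw [hfull, top_le_iff] at hle
  ext j
  have h : L (Pi.single j 1) = 0 := by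
    rw [← LinearMap.mem_ker, hle]
    trivial
  have h' : L (Pi.single j 1) = (β j : ℝ) := by
    simp [L, dot, Pi.single_apply]
  rw [h'] at h
  exact_mod_cast h

/-- Dickson's lemma: the values on the generators turn divisibility into the componentwise order on
`ℕ^m`. -/
theorem IsGeneratedBy.wellQuasiOrdered_divides (hv : IsGeneratedBy σ v) :
    WellQuasiOrdered (Divides (σ := σ)) := by
  intro f
  obtain ⟨a, b, hab, h⟩ := wellQuasiOrdered_le (α := Fin m → ℕ)
    (fun n i => (pairing v (f n) i).toNat)
  refine ⟨a, b, hab, (hv.divides_iff _ _).2 fun i => ?_⟩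
  have h1 := (hv.mem_dualMonoid _).1 (f a).2 i
  have h2 := (hv.mem_dualMonoid _).1 (f b).2 i
  have h3 : (pairing v (f a) i).toNat ≤ (pairing v (f b) i).toNat := h i
  change pairing v (f a) i ≤ pairing v (f b) i
  omega

/-- Strong convexity yields a functional `ℓ` positive on all non-zero generators. A bound on `ℓ`
then bounds their coefficients, so each slice `ℓ < K` of the cone lies in a compact set of
nonnegative combinations. -/
theorem IsGeneratedBy.isClosed (hv : IsGeneratedBy σ v) (hconv : IsStronglyConvex σ) :
    IsClosed (σ : Set (Fin d → ℝ)) := by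
  classical
  let cast : (Fin d → ℤ) → Fin d → ℝ := fun u j => (u j : ℝ)
  have hcast : ∀ u, cast u = 0 → u = 0 := by
    intro u hu
    ext j
    have := congrFun hu j
    simpa [cast] using this
  obtain ⟨y, hy⟩ := exists_forall_sum_pos {u : Fin d → ℤ | cast u ∈ σ ∧ u ≠ 0}
    (by
      rintro a ⟨ha, ha0⟩ b ⟨hb, hb0⟩
      have hab : cast (a + b) = cast a + cast b := by ext; simp [cast]
      refine ⟨hab ▸ add_mem ha hb, fun h => ha0 (hcast a (hconv _ ha ?_))⟩
      have : -cast a = cast b := by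
        rw [h] at hab
        have : cast 0 = 0 := by ext; simp [cast]
        rw [this] at hab
        exact neg_eq_of_add_eq_zero_right hab.symm
      rw [this]
      exact hb)
    (by simp) ((Finset.univ.image v).filter (· ≠ 0))
    (by
      intro a ha
      obtain ⟨ha, ha0⟩ := Finset.mem_filter.1 ha
      obtain ⟨i, -, rfl⟩ := Finset.mem_image.1 ha
      exact ⟨hv.generator_mem i, ha0⟩)
  let ℓ : (Fin d → ℝ) → ℝ := fun x => ∑ j, y j * x j
  have hℓ : Continuous ℓ := by fun_prop
  let b : Fin m → ℝ := fun i => ℓ (cast (v i))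
  have hb : ∀ i, v i ≠ 0 → 0 < b i := fun i hi =>
    hy (v i) (Finset.mem_filter.2 ⟨Finset.mem_image_of_mem _ (Finset.mem_univ i), hi⟩)
  let F : (Fin m → ℝ) → Fin d → ℝ := fun c j => ∑ i, c i * (v i j : ℝ)
  have hF : Continuous F := by fun_prop
  have hℓF : ∀ c, ℓ (F c) = ∑ i, c i * b i := by
    intro c
    simp only [ℓ, F, b, cast, Finset.mul_sum]
    rw [Finset.sum_comm]
    exact Finset.sum_congr rfl fun i _ => Finset.sum_congr rfl fun j _ => by ring
  have hFmem : ∀ c, (∀ i, 0 ≤ c i) → F c ∈ σ := fun c hc => (hv _).2 ⟨c, hc, rfl⟩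
  refine isClosed_of_closure_subset fun u hu => ?_
  let K : ℝ := ℓ u + 1
  let T : Set (Fin d → ℝ) := F '' (Set.univ.pi fun i => Set.Icc (0 : ℝ) (K / b i))
  have hT : IsCompact T := (isCompact_univ_pi fun i => isCompact_Icc).image hF
  have hsub : (σ : Set (Fin d → ℝ)) ∩ {x | ℓ x < K} ⊆ T := by
    rintro x ⟨hx, hxK⟩
    obtain ⟨c, hc, rfl⟩ := (hv x).1 hx
    -- Zero generators have `b i = 0`, so `K / b i = 0` and the interval is `{0}`; their
    -- coefficients are reset to `0` without changing the point.
    refine ⟨fun i => if v i = 0 then 0 else c i, ?_, ?_⟩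
    · intro i _
      by_cases hi : v i = 0
      · have : b i = 0 := by simp [b, cast, ℓ, hi]
        simp [hi, this]
      · simp only [hi, if_false]
        refine ⟨hc i, ?_⟩
        rw [le_div_iff₀ (hb i hi)]
        have h1 : c i * b i ≤ ∑ k, c k * b k := by
          refine Finset.single_le_sum (f := fun k => c k * b k) (fun k _ => ?_) (Finset.mem_univ i)
          by_cases hk : v k = 0
          · have : b k = 0 := by simp [b, cast, ℓ, hk]
            simp [this]
          · exact mul_nonneg (hc k) (hb k hk).le
        have h2 : ℓ (F c) < K := hxK
        rw [hℓF] at h2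
        exact h1.trans h2.le
    · ext j
      refine Finset.sum_congr rfl fun i _ => ?_
      by_cases hi : v i = 0 <;> simp [hi]
  have huT : u ∈ closure ((σ : Set (Fin d → ℝ)) ∩ {x | ℓ x < K}) := by
    have hopen : IsOpen {x | ℓ x < K} := isOpen_lt hℓ continuous_const
    rw [Set.inter_comm]
    exact hopen.inter_closure ⟨show ℓ u < K by simp [K], hu⟩
  have := closure_minimal hsub hT.isClosed huT
  obtain ⟨c, hc, rfl⟩ := this
  exact hFmem c fun i => (hc i (Set.mem_univ i)).1

end Generators
-- Initial forms and division
section Reduction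
variable {d : ℕ} {σ : PointedCone ℝ (Fin d → ℝ)}

theorem mem_supp {f : MonomialAlgebra σ} {β : Exponent σ} : β ∈ supp f ↔ f.coeff β ≠ 0 :=
  Finsupp.mem_support_iff

theorem coeff_initialForm (w : Fin d → ℝ) (f : MonomialAlgebra σ) (β : Exponent σ)
    [Decidable (β ∈ supp f ∧ ∀ γ ∈ supp f, dot w γ ≤ dot w β)] :
    (initialForm w f).coeff β =
      if β ∈ supp f ∧ ∀ γ ∈ supp f, dot w γ ≤ dot w β then f.coeff β else 0 := by
  classical
  simp only [initialForm, AddMonoidAlgebra.coeff_sum, AddMonoidAlgebra.coeff_single,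
    Finsupp.finsetSum_apply, Finsupp.single_apply, Finset.sum_ite_eq', Finset.mem_filter]

theorem mem_supp_initialForm {w : Fin d → ℝ} {f : MonomialAlgebra σ} {β : Exponent σ} :
    β ∈ supp (initialForm w f) ↔ β ∈ supp f ∧ ∀ γ ∈ supp f, dot w γ ≤ dot w β := by
  classical
  rw [mem_supp, coeff_initialForm]
  split_ifs with h
  · exact iff_of_true (mem_supp.1 h.1) h
  · exact iff_of_false (by simp) h

theorem initialForm_mem_initialIdeal (w : Fin d → ℝ) {I : Ideal (MonomialAlgebra σ)}
    {f : MonomialAlgebra σ} (hf : f ∈ I) : initialForm w f ∈ initialIdeal w I :=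
  Ideal.subset_span ⟨f, hf, rfl⟩

theorem exists_mem_supp_initialForm (w : Fin d → ℝ) {f : MonomialAlgebra σ} (hf : f ≠ 0) :
    ∃ β, β ∈ supp (initialForm w f) := by
  have hne : (supp f).Nonempty := by
    rw [supp, Finsupp.support_nonempty_iff]
    simpa using hf
  obtain ⟨β, hβ, hmax⟩ := (supp f).exists_max_image (fun β => dot w (β : Fin d → ℤ)) hne
  exact ⟨β, mem_supp_initialForm.2 ⟨hβ, hmax⟩⟩

theorem exists_mem_supp_of_mem_supp_sum {ι : Type*} {s : Finset ι} {c : ι → ℂ}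
    {r : ι → MonomialAlgebra σ} {β : Exponent σ} (hβ : β ∈ supp (∑ i ∈ s, c i • r i)) :
    ∃ i ∈ s, β ∈ supp (r i) := by
  by_contra! h
  rw [mem_supp] at hβ
  apply hβ
  simp only [AddMonoidAlgebra.coeff_sum, AddMonoidAlgebra.coeff_smul, Finsupp.finsetSum_apply,
    Finsupp.smul_apply]
  refine Finset.sum_eq_zero fun i hi => ?_
  have := h i hi
  rw [mem_supp, not_not] at this
  simp [this]

theorem sub_sum_mem {I : Ideal (MonomialAlgebra σ)} {r : Exponent σ → MonomialAlgebra σ}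
    (t : MonomialAlgebra σ) (h : ∀ γ ∈ supp t, AddMonoidAlgebra.single γ 1 - r γ ∈ I) :
    t - ∑ γ ∈ supp t, t.coeff γ • r γ ∈ I := by
  have ht : t = ∑ γ ∈ supp t, t.coeff γ • AddMonoidAlgebra.single γ (1 : ℂ) := by
    conv_lhs => rw [← t.sum_coeff_single]
    simp [Finsupp.sum, supp]
  have : t - ∑ γ ∈ supp t, t.coeff γ • r γ =
      ∑ γ ∈ supp t, t.coeff γ • (AddMonoidAlgebra.single γ (1 : ℂ) - r γ) := by
    simp only [smul_sub, Finset.sum_sub_distrib]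
    rw [← ht]
  rw [this]
  exact Ideal.sum_mem _ fun γ hγ => Submodule.smul_of_tower_mem I _ (h γ hγ)

/-- Every monomial is congruent modulo `I` to a combination of monomials outside `M`, if every
monomial in `M` can be rewritten modulo `I` in terms of smaller ones. -/
theorem exists_normalForm (I : Ideal (MonomialAlgebra σ)) {R : Exponent σ → Exponent σ → Prop}
    (hwf : WellFounded R) (htrans : ∀ a b c, R a b → R b c → R a c) (M : Set (Exponent σ))
    (hM : ∀ β ∈ M, ∃ F ∈ I, F.coeff β = 1 ∧ ∀ γ ∈ supp F, γ ≠ β → R γ β) (β : Exponent σ) :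
    ∃ r : MonomialAlgebra σ, AddMonoidAlgebra.single β 1 - r ∈ I ∧ (∀ γ ∈ supp r, γ ∉ M) ∧
      (β ∉ M → r = AddMonoidAlgebra.single β 1) ∧ (β ∈ M → ∀ γ ∈ supp r, R γ β) := by
  classical
  induction β using hwf.induction with
  | _ β ih =>
    by_cases hβ : β ∈ M
    · obtain ⟨F, hFI, hF1, hF⟩ := hM β hβ
      choose! r hr using ih
      -- `t` is congruent to the monomial `β` modulo `I` and has only smaller monomials, whose
      -- normal forms come from induction.
      let t : MonomialAlgebra σ := AddMonoidAlgebra.single β 1 - F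
      have ht : ∀ γ ∈ supp t, R γ β := by
        intro γ hγ
        rw [mem_supp] at hγ
        by_cases h : γ = β
        · subst h
          simp [t, hF1] at hγ
        · refine hF γ (mem_supp.2 ?_) h
          simpa [t, Finsupp.single_apply, Ne.symm h] using hγ
      refine ⟨∑ γ ∈ supp t, t.coeff γ • r γ, ?_, ?_, fun h => absurd hβ h, fun _ => ?_⟩
      · have h1 := sub_sum_mem (I := I) t (fun γ hγ => (hr γ (ht γ hγ)).1)
        have h2 := I.add_mem hFI h1
        convert h2 using 1
        simp only [t]
        abel
      · intro γ hγ
        obtain ⟨δ, hδ, h⟩ := exists_mem_supp_of_mem_supp_sum hγ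
        exact (hr δ (ht δ hδ)).2.1 γ h
      · intro γ hγ
        obtain ⟨δ, hδ, h⟩ := exists_mem_supp_of_mem_supp_sum hγ
        have hδR := ht δ hδ
        by_cases hδM : δ ∈ M
        · exact htrans _ _ _ ((hr δ hδR).2.2.2 hδM γ h) hδR
        · rw [(hr δ hδR).2.2.1 hδM, mem_supp] at h
          have : δ = γ := by
            by_contra hne
            simp [hne] at h
          exact this ▸ hδR
    · refine ⟨AddMonoidAlgebra.single β 1, by simp, ?_, fun _ => rfl, fun h => absurd h hβ⟩
      intro γ hγ
      rw [mem_supp] at hγ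
      have : β = γ := by
        by_contra hne
        simp [hne] at hγ
      exact this ▸ hβ

/-- The strict part of a monomial ordering. -/
def MonomialOrdering.lt (τ : MonomialOrdering σ) (a b : Exponent σ) : Prop := τ.le a b ∧ a ≠ b

theorem MonomialOrdering.lt_trans (τ : MonomialOrdering σ) (a b c : Exponent σ)
    (hab : τ.lt a b) (hbc : τ.lt b c) : τ.lt a c :=
  ⟨τ.trans _ _ _ hab.1 hbc.1, fun h => hab.2 (τ.antisymm _ _ hab.1 (h ▸ hbc.1))⟩

/-- The ordering extends divisibility, hence inherits its well-quasi-order property. -/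
theorem MonomialOrdering.wellFounded_lt (τ : MonomialOrdering σ)
    (hwqo : WellQuasiOrdered (Divides (σ := σ))) : WellFounded τ.lt := by
  have hle : WellQuasiOrdered τ.le := fun f => by
    obtain ⟨m, n, hmn, h⟩ := hwqo f
    exact ⟨m, n, hmn, τ.le_of_divides _ _ h⟩
  have : IsPreorder (Exponent σ) τ.le := { refl := τ.refl, trans := τ.trans }
  refine Subrelation.wf ?_ hle.wellFounded
  intro a b h
  exact ⟨h.1, fun h' => h.2 (τ.antisymm _ _ h.1 h')⟩

theorem exists_mem_supp_of_mem_supp_single_mul {δ γ : Exponent σ} {g : MonomialAlgebra σ}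
    (h : γ ∈ supp (AddMonoidAlgebra.single δ 1 * g)) : ∃ γ' ∈ supp g, γ = δ + γ' := by
  classical
  have h1 := AddMonoidAlgebra.support_coeff_mul_subset _ _ h
  rw [AddMonoidAlgebra.coeff_single, Finsupp.support_single _ one_ne_zero] at h1
  obtain ⟨a, ha, b, hb, rfl⟩ := Finset.mem_add.1 h1
  exact ⟨b, hb, by rw [Finset.mem_singleton.1 ha]⟩

/-- The normal form of `f` lies in `I` and has no monomial divisible by a leading monomial of `B`,
so it is zero. But an undivided `γ` of top weight would keep its coefficient: rewriting another
monomial of `f` creates only monomials of weight strictly below that of `γ`. -/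
theorem IsReducedGroebnerBasis.exists_divides_of_mem_supp_initialForm {τ : MonomialOrdering σ}
    {I : Ideal (MonomialAlgebra σ)} {B : Finset (MonomialAlgebra σ)}
    (hwqo : WellQuasiOrdered (Divides (σ := σ))) (hB : IsReducedGroebnerBasis τ I B)
    {w : Fin d → ℝ}
    (hw : ∀ g ∈ B, ∀ β ∈ supp g, β ≠ lm τ g → dot w β < dot w (lm τ g))
    {f : MonomialAlgebra σ} (hf : f ∈ I) {γ : Exponent σ} (hγ : γ ∈ supp (initialForm w f)) :
    ∃ g ∈ B, Divides (lm τ g) γ := by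
  classical
  by_contra hcon
  let M : Set (Exponent σ) := {β | ∃ g ∈ B, Divides (lm τ g) β}
  let R : Exponent σ → Exponent σ → Prop := fun a b => τ.lt a b ∧ dot w a < dot w b
  have hwf : WellFounded R := Subrelation.wf (fun h => h.1) (τ.wellFounded_lt hwqo)
  have hM : ∀ β ∈ M, ∃ F ∈ I, F.coeff β = 1 ∧ ∀ γ ∈ supp F, γ ≠ β → R γ β := by
    rintro β ⟨g, hg, δ, rfl⟩
    refine ⟨AddMonoidAlgebra.single δ 1 * g, I.mul_mem_left _ (hB.1.1 g hg).1, ?_, ?_⟩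
    · rw [add_comm, AddMonoidAlgebra.coeff_single_mul_add, one_mul, (hB.2 g hg).1]
    · intro γ hγ hne
      obtain ⟨γ', hγ', rfl⟩ := exists_mem_supp_of_mem_supp_single_mul hγ
      have hne' : γ' ≠ lm τ g := fun h => hne (by rw [h, add_comm])
      rw [add_comm δ γ'] at hne ⊢
      refine ⟨⟨τ.add_le_add _ _ _ ((lm_spec τ (hB.1.1 g hg).2).2 _ hγ'), hne⟩, ?_⟩
      simpa [dot_add] using hw g hg γ' hγ' hne'
  choose r hrI hrM hr1 hr2 using exists_normalForm I hwf
    (fun a b c hab hbc => ⟨τ.lt_trans _ _ _ hab.1 hbc.1, hab.2.trans hbc.2⟩) M hM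
  let s : MonomialAlgebra σ := ∑ β ∈ supp f, f.coeff β • r β
  have hsI : s ∈ I := by
    have := I.sub_mem hf (sub_sum_mem (I := I) f (fun β _ => hrI β))
    simpa [s] using this
  have hs0 : s = 0 := by
    by_contra hne
    obtain ⟨β, -, hβ⟩ := exists_mem_supp_of_mem_supp_sum (lm_spec τ hne).1
    exact hrM β _ hβ (hB.1.2 s hsI hne)
  obtain ⟨hγf, hmax⟩ := mem_supp_initialForm.1 hγ
  have hγM : γ ∉ M := hcon
  have hc : s.coeff γ = f.coeff γ := by
    simp only [s, AddMonoidAlgebra.coeff_sum, AddMonoidAlgebra.coeff_smul,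
      Finsupp.finsetSum_apply, Finsupp.smul_apply]
    rw [Finset.sum_eq_single γ]
    · rw [hr1 γ hγM]
      simp
    · intro β hβ hne
      have : (r β).coeff γ = 0 := by
        by_contra h
        by_cases hβM : β ∈ M
        · exact absurd (hmax β hβ) (not_le.2 (hr2 β hβM γ (mem_supp.2 h)).2)
        · rw [hr1 β hβM] at h
          simp [hne] at h
      simp [this]
    · exact fun h => absurd hγf h
  rw [hs0] at hc
  exact mem_supp.1 hγf hc.symm

theorem IsReducedGroebnerBasis.eq_lm_of_divides {τ : MonomialOrdering σ}
    {I : Ideal (MonomialAlgebra σ)} {B : Finset (MonomialAlgebra σ)}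
    (hB : IsReducedGroebnerBasis τ I B) {g h : MonomialAlgebra σ} (hg : g ∈ B) (hh : h ∈ B)
    {β : Exponent σ} (hβ : β ∈ supp g) (hd : Divides (lm τ h) β) : β = lm τ g := by
  by_cases hne : h = g
  · subst hne
    exact τ.antisymm _ _ ((lm_spec τ (hB.1.1 h hh).2).2 β hβ) (τ.le_of_divides _ _ hd)
  · exact absurd hd ((hB.2 g hg).2 β hβ h hh hne)

theorem IsReducedGroebnerBasis.initialForm_eq {τ : MonomialOrdering σ}
    {I : Ideal (MonomialAlgebra σ)} {B : Finset (MonomialAlgebra σ)}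
    (hB : IsReducedGroebnerBasis τ I B) {g : MonomialAlgebra σ} (hg : g ∈ B) {w : Fin d → ℝ}
    (hw : ∀ β ∈ supp g, β ≠ lm τ g → dot w β < dot w (lm τ g)) :
    initialForm w g = AddMonoidAlgebra.single (lm τ g) 1 := by
  classical
  have hlm := (lm_spec τ (hB.1.1 g hg).2).1
  ext β
  rw [coeff_initialForm, AddMonoidAlgebra.coeff_single, Finsupp.single_apply]
  by_cases h : lm τ g = β
  · subst h
    have hmax : ∀ γ ∈ supp g, dot w γ ≤ dot w (lm τ g) := fun γ hγ => by
      by_cases hγl : γ = lm τ g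
      · rw [hγl]
      · exact (hw γ hγ hγl).le
    rw [if_pos ⟨hlm, hmax⟩, (hB.2 g hg).1, if_pos rfl]
  · rw [if_neg h, if_neg]
    rintro ⟨hβ, hmax⟩
    exact absurd (hmax _ hlm) (not_le.2 (hw β hβ (Ne.symm h)))

/-- The right-hand side does not involve `w`, so any two strict weights have the same initial ideal.
-/
theorem IsReducedGroebnerBasis.initialIdeal_eq {τ : MonomialOrdering σ}
    {I : Ideal (MonomialAlgebra σ)} {B : Finset (MonomialAlgebra σ)}
    (hwqo : WellQuasiOrdered (Divides (σ := σ))) (hB : IsReducedGroebnerBasis τ I B)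
    {w : Fin d → ℝ}
    (hw : ∀ g ∈ B, ∀ β ∈ supp g, β ≠ lm τ g → dot w β < dot w (lm τ g)) :
    initialIdeal w I =
      Ideal.span (AddMonoidAlgebra.of' ℂ (Exponent σ) '' (lm τ '' (B : Set (MonomialAlgebra σ)))) := by
  apply le_antisymm
  · rw [initialIdeal, Ideal.span_le]
    rintro _ ⟨f, hf, rfl⟩
    rw [SetLike.mem_coe, AddMonoidAlgebra.mem_ideal_span_of'_image]
    intro γ hγ
    obtain ⟨g, hg, δ, hδ⟩ := hB.exists_divides_of_mem_supp_initialForm hwqo hw hf hγ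
    exact ⟨_, ⟨g, hg, rfl⟩, δ, by rw [hδ, add_comm]⟩
  · rw [Ideal.span_le]
    rintro _ ⟨_, ⟨g, hg, rfl⟩, rfl⟩
    have := initialForm_mem_initialIdeal w (hB.1.1 g hg).1
    rw [hB.initialForm_eq hg (hw g hg)] at this
    exact this

end Reduction
-- Strict weights and the cone of a marked basis
section MarkedCone
variable {d : ℕ} {σ : PointedCone ℝ (Fin d → ℝ)} {m : ℕ} {v : Fin m → Fin d → ℤ}

/-- The theorem of the alternative is applied in generator coordinates, to the non-zero vectors
dominating a difference `α - β` with `β ≤ α` in the ordering. Allowing domination puts the unit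
vectors in the set, which makes the coefficients `c i` positive and the weight a point of `σ`. -/
theorem IsGeneratedBy.exists_strict_weight (hv : IsGeneratedBy σ v) (hfull : IsFullDimensional σ)
    (τ : MonomialOrdering σ) (B : Finset (MonomialAlgebra σ)) (hB : ∀ g ∈ B, g ≠ 0) :
    ∃ w ∈ σ, ∀ g ∈ B, ∀ β ∈ supp g, β ≠ lm τ g → dot w β < dot w (lm τ g) := by
  classical
  have hinj := hv.pairing_injective hfull
  obtain ⟨c, hc⟩ := exists_forall_sum_pos
    {y : Fin m → ℤ | y ≠ 0 ∧ ∃ α β : Exponent σ, τ.le β α ∧ pairing v α - pairing v β ≤ y}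
    (by
      rintro y ⟨hy0, α, β, hle, hy⟩ z ⟨hz0, α', β', hle', hz⟩
      have h1 : τ.le (β + β') (α + β') := τ.add_le_add _ _ _ hle
      have h2 : τ.le (α + β') (α + α') := by
        rw [add_comm α β', add_comm α α']
        exact τ.add_le_add _ _ _ hle'
      have h3 : pairing v ((α + α' : Exponent σ) : Fin d → ℤ) -
          pairing v ((β + β' : Exponent σ) : Fin d → ℤ) ≤ y + z := by
        calc _ = (pairing v α - pairing v β) + (pairing v α' - pairing v β') := by
              simp only [AddSubmonoid.coe_add, map_add]
              abel
          _ ≤ y + z := add_le_add hy hz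
      refine ⟨fun h => hy0 ?_, α + α', β + β', τ.trans _ _ _ h1 h2, h3⟩
      -- If `y + z = 0`, then `α + α'` divides `β + β'`, which closes a cycle in the ordering. Both
      -- differences vanish, so `y` and `z` are nonnegative with sum zero.
      rw [h, sub_nonpos] at h3
      have h4 := τ.le_of_divides _ _ ((hv.divides_iff _ _).2 h3)
      have h5 : β = α := add_right_cancel (τ.antisymm _ _ h1 (τ.trans _ _ _ h2 h4))
      have h6 : β' = α' := add_left_cancel (τ.antisymm _ _ h2 (τ.trans _ _ _ h4 h1))
      rw [h5, sub_self] at hy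
      rw [h6, sub_self] at hz
      exact le_antisymm (by rw [← h]; exact le_add_of_nonneg_right hz) hy)
    (fun h => h.1 rfl)
    (B.biUnion (fun g => ((supp g).filter (· ≠ lm τ g)).image
      (fun β : Exponent σ => pairing v (lm τ g) - pairing v β)) ∪
      Finset.univ.image (fun i => Pi.single i 1))
    (by
      intro a ha
      rcases Finset.mem_union.1 ha with ha | ha
      · obtain ⟨g, hg, ha⟩ := Finset.mem_biUnion.1 ha
        obtain ⟨β, hβ, rfl⟩ := Finset.mem_image.1 ha
        obtain ⟨hβ, hne⟩ := Finset.mem_filter.1 hβ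
        refine ⟨fun h => hne ?_, _, _, (lm_spec τ (hB g hg)).2 β hβ, le_rfl⟩
        exact Subtype.ext (hinj (sub_eq_zero.1 h)).symm
      · obtain ⟨i, -, rfl⟩ := Finset.mem_image.1 ha
        refine ⟨by simp, 0, 0, τ.refl _, ?_⟩
        rw [sub_self]
        exact Pi.single_nonneg.2 zero_le_one)
  refine ⟨_, (hv _).2 ⟨c, fun i => ?_, rfl⟩, fun g hg β hβ hne => ?_⟩
  · have := hc _ (Finset.mem_union_right _
      (Finset.mem_image_of_mem (fun i => Pi.single i 1) (Finset.mem_univ i)))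
    simp only [Pi.single_apply, Int.cast_ite, Int.cast_one, Int.cast_zero, mul_ite, mul_one,
      mul_zero, Finset.sum_ite_eq', Finset.mem_univ, if_true] at this
    exact this.le
  · have := hc _ (Finset.mem_union_left _ (Finset.mem_biUnion.2 ⟨g, hg,
      Finset.mem_image_of_mem (fun β : Exponent σ => pairing v (lm τ g) - pairing v β)
        (Finset.mem_filter.2 ⟨hβ, hne⟩)⟩))
    rw [← sub_pos, ← dot_sub, dot_combination, map_sub]
    exact this

theorem mem_markedCone_image {τ : MonomialOrdering σ} {B : Finset (MonomialAlgebra σ)}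
    {w : Fin d → ℝ} :
    w ∈ markedCone ((fun g => (g, lm τ g)) '' (B : Set (MonomialAlgebra σ))) ↔
      w ∈ σ ∧ ∀ g ∈ B, ∀ β ∈ supp g, dot w β ≤ dot w (lm τ g) := by
  simp [markedCone, dot_sub]

theorem dot_add_smul (u w : Fin d → ℝ) (t : ℝ) (β : Fin d → ℤ) :
    dot (u + t • w) β = dot u β + t * dot w β := by
  simp [dot, add_mul, Finset.sum_add_distrib, Finset.mul_sum, mul_assoc]

theorem IsGeneratedBy.isClosed_markedCone (hv : IsGeneratedBy σ v) (hconv : IsStronglyConvex σ)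
    (G : Set (MonomialAlgebra σ × Exponent σ)) : IsClosed (markedCone G) := by
  have : markedCone G = (σ : Set (Fin d → ℝ)) ∩ ⋂ p ∈ G, ⋂ β ∈ supp p.1,
      {w | 0 ≤ dot w ((p.2 : Fin d → ℤ) - (β : Fin d → ℤ))} := by
    ext w
    simp [markedCone]
  rw [this]
  refine (hv.isClosed hconv).inter (isClosed_biInter fun p _ => isClosed_biInter fun β _ => ?_)
  refine isClosed_le continuous_const ?_
  unfold dot
  fun_prop

theorem IsGeneratedBy.markedCone_mem_groebnerFan (hv : IsGeneratedBy σ v)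
    (hconv : IsStronglyConvex σ) (hfull : IsFullDimensional σ) {I : Ideal (MonomialAlgebra σ)}
    {τ : MonomialOrdering σ} {B : Finset (MonomialAlgebra σ)}
    (hB : IsReducedGroebnerBasis τ I B) :
    markedCone ((fun g => (g, lm τ g)) '' (B : Set (MonomialAlgebra σ))) ∈ groebnerFan I := by
  have hwqo := hv.wellQuasiOrdered_divides
  obtain ⟨w, hwσ, hw⟩ := hv.exists_strict_weight hfull τ B (fun g hg => (hB.1.1 g hg).2)
  refine ⟨w, hwσ, subset_antisymm ?_ (closure_minimal ?_ (hv.isClosed_markedCone hconv _))⟩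
  · intro u hu
    rw [mem_markedCone_image] at hu
    -- Approach `u` by strict weights, adding ever smaller multiples of `w`.
    have hlim : Filter.Tendsto (fun n : ℕ => u + (1 / ((n : ℝ) + 1)) • w) Filter.atTop (nhds u) := by
      have := (tendsto_one_div_add_atTop_nhds_zero_nat (𝕜 := ℝ)).smul_const w
      simpa using this.const_add u
    refine mem_closure_of_tendsto hlim (Filter.Eventually.of_forall fun n => ?_)
    have hn : (0 : ℝ) < 1 / ((n : ℝ) + 1) := by positivity
    refine ⟨add_mem hu.1 (σ.smul_mem hn.le hwσ), ?_⟩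
    rw [hB.initialIdeal_eq hwqo hw, hB.initialIdeal_eq hwqo]
    intro g hg β hβ hne
    rw [dot_add_smul, dot_add_smul]
    exact add_lt_add_of_le_of_lt (hu.2 g hg β hβ) (mul_lt_mul_of_pos_left (hw g hg β hβ hne) hn)
  · rintro w' ⟨hw'σ, hw'⟩
    refine mem_markedCone_image.2 ⟨hw'σ, fun g hg => ?_⟩
    have hmem := initialForm_mem_initialIdeal w' (hB.1.1 g hg).1
    rw [hw', hB.initialIdeal_eq hwqo hw, AddMonoidAlgebra.mem_ideal_span_of'_image] at hmem
    obtain ⟨α, hα⟩ := exists_mem_supp_initialForm w' (hB.1.1 g hg).2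
    obtain ⟨_, ⟨h, hh, rfl⟩, δ, hδ⟩ := hmem α hα
    obtain ⟨hαg, hmax⟩ := mem_supp_initialForm.1 hα
    -- By reducedness, a monomial of `g` divisible by some leading monomial can only be the leading
    -- monomial of `g`.
    have := hB.eq_lm_of_divides hg hh hαg ⟨δ, by rw [hδ, add_comm]⟩
    rwa [this] at hmax

end MarkedCone

/-! ### Weight orderings, reduced bases and lifting from the initial ideal -/

section Orderings
variable {d : ℕ} {σ : PointedCone ℝ (Fin d → ℝ)} {m : ℕ} {v : Fin m → Fin d → ℤ}

/-- The lexicographic ordering of the values on the generators of the cone. -/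
def IsGeneratedBy.lexOrdering (hv : IsGeneratedBy σ v) (hfull : IsFullDimensional σ) :
    MonomialOrdering σ where
  le a b := toLex (pairing v a) ≤ toLex (pairing v b)
  refl _ := le_rfl
  trans _ _ _ := le_trans
  antisymm a b h h' :=
    Subtype.ext (hv.pairing_injective hfull (toLex.injective (le_antisymm h h')))
  total a b := le_total _ _
  le_of_divides β α h := Pi.toLex_monotone ((hv.divides_iff β α).1 h)
  add_le_add β α γ h := by
    simp only [AddSubmonoid.coe_add, map_add, toLex_add]
    exact add_le_add_left h _

/-- The ordering by `w`-weight, with ties broken by `τ`. -/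
def MonomialOrdering.refineWeight (τ : MonomialOrdering σ) {w : Fin d → ℝ} (hw : w ∈ σ) :
    MonomialOrdering σ where
  le a b := dot w a < dot w b ∨ dot w a = dot w b ∧ τ.le a b
  refl a := Or.inr ⟨rfl, τ.refl a⟩
  trans a b c := by
    rintro (h | ⟨h, h'⟩) (k | ⟨k, k'⟩)
    · exact Or.inl (h.trans k)
    · exact Or.inl (k ▸ h)
    · exact Or.inl (h ▸ k)
    · exact Or.inr ⟨h.trans k, τ.trans _ _ _ h' k'⟩
  antisymm a b := by
    rintro (h | ⟨h, h'⟩) (k | ⟨k, k'⟩)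
    · exact absurd h k.not_gt
    · exact absurd h k.not_gt
    · exact absurd k h.not_gt
    · exact τ.antisymm _ _ h' k'
  total a b := by
    rcases lt_trichotomy (dot w a) (dot w b) with h | h | h
    · exact Or.inl (Or.inl h)
    · exact (τ.total a b).imp (fun k => Or.inr ⟨h, k⟩) (fun k => Or.inr ⟨h.symm, k⟩)
    · exact Or.inr (Or.inl h)
  le_of_divides β α h := by
    have hτ := τ.le_of_divides β α h
    obtain ⟨γ, rfl⟩ := h
    have h0 := γ.2 w hw
    rw [AddSubmonoid.coe_add, dot_add]
    -- The quotient monomial has nonnegative weight because `w ∈ σ`; in weight zero, `τ` decides.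
    rcases h0.lt_or_eq with h0 | h0
    · exact Or.inl (by linarith)
    · exact Or.inr ⟨by linarith, hτ⟩
  add_le_add β α γ := by
    simp only [AddSubmonoid.coe_add, dot_add]
    rintro (h | ⟨h, h'⟩)
    · exact Or.inl (by linarith)
    · exact Or.inr ⟨by linarith, τ.add_le_add _ _ _ h'⟩

theorem lm_eq (τ : MonomialOrdering σ) {f : MonomialAlgebra σ} {α : Exponent σ}
    (hα : α ∈ supp f) (hmax : ∀ β ∈ supp f, τ.le β α) : lm τ f = α := by
  have hf : f ≠ 0 := by
    rintro rfl
    simp [supp] at hα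
  exact τ.antisymm _ _ (hmax _ (lm_spec τ hf).1) ((lm_spec τ hf).2 α hα)

/-- The exponents of the leading monomials of the non-zero elements of `I`. -/
def leadingExponents (τ : MonomialOrdering σ) (I : Ideal (MonomialAlgebra σ)) :
    Set (Exponent σ) :=
  {α | ∃ f ∈ I, f ≠ 0 ∧ lm τ f = α}

theorem mem_leadingExponents_of_divides {τ : MonomialOrdering σ} {I : Ideal (MonomialAlgebra σ)}
    {α β : Exponent σ} (hα : α ∈ leadingExponents τ I) (h : Divides α β) :
    β ∈ leadingExponents τ I := by
  obtain ⟨f, hf, hf0, rfl⟩ := hα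
  obtain ⟨δ, rfl⟩ := h
  have hc : lm τ f + δ ∈ supp (AddMonoidAlgebra.single δ 1 * f) := by
    rw [mem_supp, add_comm, AddMonoidAlgebra.coeff_single_mul_add, one_mul]
    exact mem_supp.1 (lm_spec τ hf0).1
  refine ⟨AddMonoidAlgebra.single δ 1 * f, I.mul_mem_left _ hf, ?_, lm_eq τ hc ?_⟩
  · intro h
    simp [h, supp] at hc
  · intro γ hγ
    obtain ⟨γ', hγ', rfl⟩ := exists_mem_supp_of_mem_supp_single_mul hγ
    rw [add_comm δ]
    exact τ.add_le_add _ _ _ ((lm_spec τ hf0).2 γ' hγ')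

theorem exists_monic_of_mem_leadingExponents {τ : MonomialOrdering σ}
    {I : Ideal (MonomialAlgebra σ)} {α : Exponent σ} (hα : α ∈ leadingExponents τ I) :
    ∃ F ∈ I, F.coeff α = 1 ∧ ∀ γ ∈ supp F, γ ≠ α → τ.lt γ α := by
  obtain ⟨f, hf, hf0, rfl⟩ := hα
  have h0 := mem_supp.1 (lm_spec τ hf0).1
  refine ⟨(f.coeff (lm τ f))⁻¹ • f, Submodule.smul_of_tower_mem I _ hf, ?_, fun γ hγ hne => ?_⟩
  · simp [h0]
  · refine ⟨(lm_spec τ hf0).2 γ (mem_supp.2 fun h => ?_), hne⟩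
    rw [mem_supp] at hγ
    simp [h] at hγ

/-- The divisibility-minimal leading exponents form an antichain, hence a finite set. Subtracting
from each its normal form modulo all leading exponents gives the basis, and the tails are reduced
automatically. -/
theorem exists_isReducedGroebnerBasis (hwqo : WellQuasiOrdered (Divides (σ := σ)))
    (τ : MonomialOrdering σ) (I : Ideal (MonomialAlgebra σ)) :
    ∃ B, IsReducedGroebnerBasis τ I B := by
  classical
  let M := leadingExponents τ I
  let Mmin : Set (Exponent σ) := {α | α ∈ M ∧ ∀ β ∈ M, Divides β α → β = α}
  have hfin : Mmin.Finite := by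
    refine IsAntichain.finite_of_wellQuasiOrdered (r := Divides) ?_ hwqo
    intro a ha b hb hne hd
    exact hne (hb.2 a ha.1 hd)
  have hmin : ∀ β ∈ M, ∃ α ∈ Mmin, Divides α β := by
    intro β hβ
    have : IsPreorder (Exponent σ) Divides :=
      { refl := fun a => ⟨0, (add_zero a).symm⟩
        trans := by
          rintro a _ _ ⟨x, rfl⟩ ⟨y, rfl⟩
          exact ⟨x + y, add_assoc _ _ _⟩ }
    obtain ⟨α, ⟨hαM, hαβ⟩, hα⟩ := hwqo.wellFounded.has_min {α | α ∈ M ∧ Divides α β}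
      ⟨β, hβ, refl_of Divides β⟩
    refine ⟨α, ⟨hαM, fun γ hγ hd => ?_⟩, hαβ⟩
    have h := hα γ ⟨hγ, trans_of Divides hd hαβ⟩
    have h' : Divides α γ := by
      by_contra hn
      exact h ⟨hd, hn⟩
    -- Divisibility is antisymmetric because `τ` extends it.
    exact τ.antisymm _ _ (τ.le_of_divides _ _ hd) (τ.le_of_divides _ _ h')
  choose r hrI hrM hr1 hr2 using exists_normalForm I (τ.wellFounded_lt hwqo)
    τ.lt_trans M (fun β hβ => exists_monic_of_mem_leadingExponents hβ)
  let g : Exponent σ → MonomialAlgebra σ := fun α => AddMonoidAlgebra.single α 1 - r α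
  have hg1 : ∀ α ∈ M, (g α).coeff α = 1 := by
    intro α hα
    have : (r α).coeff α = 0 := by
      by_contra h
      exact (hr2 α hα α (mem_supp.2 h)).2 rfl
    simp [g, this]
  have hg2 : ∀ α, ∀ β ∈ supp (g α), β ≠ α → β ∈ supp (r α) := by
    intro α β hβ hne
    rw [mem_supp] at hβ ⊢
    intro h
    simp [g, h, hne.symm] at hβ
  have hglm : ∀ α ∈ M, lm τ (g α) = α := by
    intro α hα
    refine lm_eq τ (mem_supp.2 (by simp [hg1 α hα])) fun β hβ => ?_
    by_cases h : β = α
    · rw [h]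
      exact τ.refl α
    · exact (hr2 α hα β (hg2 α β hβ h)).1
  refine ⟨hfin.toFinset.image g, ⟨?_, ?_⟩, ?_⟩
  · intro f hf
    obtain ⟨α, hα, rfl⟩ := Finset.mem_image.1 hf
    rw [Set.Finite.mem_toFinset] at hα
    refine ⟨hrI α, fun h => ?_⟩
    have := hg1 α hα.1
    simp [h] at this
  · intro f hf hf0
    obtain ⟨α, hα, hd⟩ := hmin (lm τ f) ⟨f, hf, hf0, rfl⟩
    exact ⟨g α, Finset.mem_image_of_mem g (hfin.mem_toFinset.2 hα), by rwa [hglm α hα.1]⟩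
  · intro f hf
    obtain ⟨α, hα, rfl⟩ := Finset.mem_image.1 hf
    rw [Set.Finite.mem_toFinset] at hα
    refine ⟨by rw [hglm α hα.1, hg1 α hα.1], ?_⟩
    intro β hβ h hh hne hd
    obtain ⟨α', hα', rfl⟩ := Finset.mem_image.1 hh
    rw [Set.Finite.mem_toFinset] at hα'
    rw [hglm α' hα'.1] at hd
    by_cases hβα : β = α
    · subst hβα
      exact hne (congrArg g (hα.2 α' hα'.1 hd))
    · exact hrM α β (hg2 α β hβ hβα) (mem_leadingExponents_of_divides hα'.1 hd)

/-- Every `w`-homogeneous part of an element of `in_w(I)` is the top part of an element of `I`. -/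
theorem exists_coeff_eq_of_mem_initialIdeal {I : Ideal (MonomialAlgebra σ)} {w : Fin d → ℝ}
    {h : MonomialAlgebra σ} (hh : h ∈ initialIdeal w I) (a : ℝ) :
    ∃ F ∈ I, (∀ β ∈ supp F, dot w β ≤ a) ∧
      ∀ β : Exponent σ, dot w β = a → F.coeff β = h.coeff β := by
  classical
  induction hh using Submodule.span_induction generalizing a with
  | mem x hx =>
    obtain ⟨f, hf, rfl⟩ := hx
    -- An initial form lives in a single weight: at that level `f` itself is a lift, at any other
    -- level `0` is.
    by_cases hα : ∃ α ∈ supp (initialForm w f), dot w (α : Fin d → ℤ) = a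
    · obtain ⟨α, hα, rfl⟩ := hα
      obtain ⟨hαf, hmax⟩ := mem_supp_initialForm.1 hα
      refine ⟨f, hf, hmax, fun β hβ => ?_⟩
      rw [coeff_initialForm]
      split_ifs with hc
      · rfl
      · by_contra h0
        exact hc ⟨mem_supp.2 h0, fun γ hγ => hβ ▸ hmax γ hγ⟩
    · refine ⟨0, I.zero_mem, by simp [supp], fun β hβ => ?_⟩
      by_contra h0
      exact hα ⟨β, mem_supp.2 (Ne.symm h0), hβ⟩
  | zero => exact ⟨0, I.zero_mem, by simp [supp], fun _ _ => rfl⟩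
  | add x y _ _ hx hy =>
    obtain ⟨F, hF, hF1, hF2⟩ := hx a
    obtain ⟨F', hF', hF1', hF2'⟩ := hy a
    refine ⟨F + F', I.add_mem hF hF', fun β hβ => ?_, fun β hβ => ?_⟩
    · rcases Finset.mem_union.1 (Finsupp.support_add hβ) with h | h
      · exact hF1 β h
      · exact hF1' β h
    · simp [hF2 β hβ, hF2' β hβ]
  | smul s x _ hx =>
    induction s using AddMonoidAlgebra.induction_linear generalizing a with
    | zero => exact ⟨0, I.zero_mem, by simp [supp], fun _ _ => by simp⟩
    | add s t hs ht =>
      obtain ⟨F, hF, hF1, hF2⟩ := hs a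
      obtain ⟨F', hF', hF1', hF2'⟩ := ht a
      refine ⟨F + F', I.add_mem hF hF', fun β hβ => ?_, fun β hβ => ?_⟩
      · rcases Finset.mem_union.1 (Finsupp.support_add hβ) with h | h
        · exact hF1 β h
        · exact hF1' β h
      · simp [add_mul, hF2 β hβ, hF2' β hβ]
    | single δ c =>
      -- Multiplication by `x^δ` shifts weights by `dot w δ`, which is why the level `a` must vary
      -- in the induction.
      obtain ⟨F, hF, hF1, hF2⟩ := hx (a - dot w δ)
      refine ⟨AddMonoidAlgebra.single δ c * F, I.mul_mem_left _ hF, fun β hβ => ?_, fun β hβ => ?_⟩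
      · by_cases hd : ∃ γ, δ + γ = β
        · obtain ⟨γ, rfl⟩ := hd
          rw [mem_supp, AddMonoidAlgebra.coeff_single_mul_add] at hβ
          have := hF1 γ (mem_supp.2 (right_ne_zero_of_mul hβ))
          rw [AddSubmonoid.coe_add, dot_add]
          linarith
        · push Not at hd
          rw [mem_supp, AddMonoidAlgebra.coeff_single_mul_of_forall_add_ne _ _ hd] at hβ
          exact absurd rfl hβ
      · rw [smul_eq_mul]
        by_cases hd : ∃ γ, δ + γ = β
        · obtain ⟨γ, rfl⟩ := hd
          rw [AddSubmonoid.coe_add, dot_add] at hβ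
          rw [AddMonoidAlgebra.coeff_single_mul_add, AddMonoidAlgebra.coeff_single_mul_add,
            hF2 γ (by linarith)]
        · push Not at hd
          rw [AddMonoidAlgebra.coeff_single_mul_of_forall_add_ne _ _ hd,
            AddMonoidAlgebra.coeff_single_mul_of_forall_add_ne _ _ hd]

/-- Lift `h` to `I` at the weight level of its `τ`-leading monomial. The lift has nothing of higher
weight and agrees with `h` on that level, so the refined ordering selects the same monomial. -/
theorem lm_mem_leadingExponents_refineWeight {I : Ideal (MonomialAlgebra σ)}
    (τ : MonomialOrdering σ) {w : Fin d → ℝ} (hw : w ∈ σ) {h : MonomialAlgebra σ}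
    (hh : h ∈ initialIdeal w I) (h0 : h ≠ 0) :
    lm τ h ∈ leadingExponents (τ.refineWeight hw) I := by
  obtain ⟨F, hF, hF1, hF2⟩ := exists_coeff_eq_of_mem_initialIdeal hh (dot w (lm τ h))
  obtain ⟨hl, hmax⟩ := lm_spec τ h0
  have hlF : lm τ h ∈ supp F := by
    rw [mem_supp, hF2 _ rfl]
    exact mem_supp.1 hl
  refine ⟨F, hF, ?_, lm_eq _ hlF fun β hβ => ?_⟩
  · rintro rfl
    simp [supp] at hlF
  · rcases (hF1 β hβ).lt_or_eq with hlt | heq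
    · exact Or.inl hlt
    · refine Or.inr ⟨heq, hmax β ?_⟩
      rw [mem_supp, ← hF2 β heq]
      exact mem_supp.1 hβ

/-- The `τ`-leading monomial of `in_{w'}(g)` is a leading exponent of `I` for the refined ordering,
so reducedness identifies it with the leading monomial of `g`. Unlike for strict weights, `in_w(I)`
need not be monomial here. -/
theorem weightClass_subset_markedCone {I : Ideal (MonomialAlgebra σ)}
    (τ : MonomialOrdering σ) {w : Fin d → ℝ} (hw : w ∈ σ) {B : Finset (MonomialAlgebra σ)}
    (hB : IsReducedGroebnerBasis (τ.refineWeight hw) I B) :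
    weightClass I w ⊆
      markedCone ((fun g => (g, lm (τ.refineWeight hw) g)) '' (B : Set (MonomialAlgebra σ))) := by
  rintro w' ⟨hw'σ, hw'⟩
  refine mem_markedCone_image.2 ⟨hw'σ, fun g hg => ?_⟩
  have hmem := initialForm_mem_initialIdeal w' (hB.1.1 g hg).1
  rw [hw'] at hmem
  have h0 : initialForm w' g ≠ 0 := by
    obtain ⟨α, hα⟩ := exists_mem_supp_initialForm w' (hB.1.1 g hg).2
    intro h
    simp [h, supp] at hα
  obtain ⟨hαg, hmax⟩ := mem_supp_initialForm.1 (lm_spec τ h0).1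
  obtain ⟨f, hf, hf0, hfl⟩ := lm_mem_leadingExponents_refineWeight τ hw hmem h0
  obtain ⟨k, hk, hd⟩ := hB.1.2 f hf hf0
  rw [hfl] at hd
  rwa [hB.eq_lm_of_divides hg hk hαg hd] at hmax

end Orderings
end ToricGroebner

theorem mainTheorem4 {d : ℕ} (σ : PointedCone ℝ (Fin d → ℝ))
    (hrat : ToricGroebner.IsRationalPolyhedral σ)
    (hconv : ToricGroebner.IsStronglyConvex σ)
    (hfull : ToricGroebner.IsFullDimensional σ)
    (I : Ideal (ToricGroebner.MonomialAlgebra σ)) (hI : I ≠ ⊥) :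
    (∀ G : Set (ToricGroebner.MonomialAlgebra σ × ToricGroebner.Exponent σ),
        ToricGroebner.IsMarkedGroebnerBasis I G →
          ToricGroebner.markedCone G ∈ ToricGroebner.groebnerFan I) ∧
      ∀ C : Set (Fin d → ℝ), Maximal (fun C' => C' ∈ ToricGroebner.groebnerFan I) C →
        ∃ G : Set (ToricGroebner.MonomialAlgebra σ × ToricGroebner.Exponent σ),
          ToricGroebner.IsMarkedGroebnerBasis I G ∧ C = ToricGroebner.markedCone G := by
  obtain ⟨m, v, hv⟩ := hrat.exists_isGeneratedBy
  refine ⟨?_, fun C hC => ?_⟩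
  · rintro G ⟨τ, B, hB, rfl⟩
    exact hv.markedCone_mem_groebnerFan hconv hfull hB
  · obtain ⟨w, hw, rfl⟩ := hC.prop
    let τ := hv.lexOrdering hfull
    obtain ⟨B, hB⟩ := ToricGroebner.exists_isReducedGroebnerBasis hv.wellQuasiOrdered_divides
      (τ.refineWeight hw) I
    refine ⟨_, ⟨_, B, hB, rfl⟩, ?_⟩
    exact hC.eq_of_subset (hv.markedCone_mem_groebnerFan hconv hfull hB)
      (closure_minimal (ToricGroebner.weightClass_subset_markedCone τ hw hB)
        (hv.isClosed_markedCone hconv _))
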